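/- Let $s>1$ be an odd integer, $q=3^s$, and let $\mathbb{F}_q$ be the finite field with $q$ elements. Let $\beta$ be a primitive $(q+1)$-th root of unity in an extension field of $\mathbb{F}_q$ (for instance in $\mathbb{F}_{q^2}$), and for $j\ge 0$ let $\mathrm{M}_{\beta^j}(x)$ be the minimal polynomial of $\beta^j$ over $\mathbb{F}_q$. Let $\mathcal{C}_{(q,q+1,3,4)}$ be the BCH code of length $q+1$ over $\mathbb{F}_q$ with designed distance $3$, that is, the cyclic code $$\Big\{(c_0,\dots,c_q)\in\mathbb{F}_q^{q+1} : \sum_{i=0}^{q}c_ix^i \in \langle g(x)\rangle \text{ in } \mathbb{F}_q[x]/(x^{q+1}-1)\Big\},\qquad g=\mathrm{lcm}\big(\mathrm{M}_{\beta^4}(x),\mathrm{M}_{\beta^5}(x)\big).$$ A linear code has parameters $[n,k,d]$ if it is a $k$-dimensional subspace of $\mathbb{F}_q^n$ and the least Hamming weight of its nonzero codewords is $d$; it is almost MDS (AMDS) if it has parameters $[n,k,n-k]$ for some $k$, and near MDS (NMDS) if both it and its dual code (with respect to the standard inner product) are AMDS. Then $\mathcal{C}_{(q,q+1,3,4)}$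 is an NMDS code with parameters $[q+1,q-3,4]$, and its dual code $\mathcal{C}^\perp_{(q,q+1,3,4)}$ has parameters $[q+1,4,q-3]$. In particular, $\mathcal{C}^\perp_{(q,q+1,3,4)}$ is an AMDS code with parameters $[q+1,4,q-3]$, which is Conjecture 3.6 of Geng et al. for $s>1$. -/

import Mathlib

open Polynomial

noncomputable section

/-- The cyclic code of length `n` over `F` generated by `g`: the words `(c₀, …, c_{n-1})` whose
image `c₀ + c₁ X + ⋯ + c_{n-1} X ^ (n-1)` lies in the ideal of `F[X] / (X ^ n - 1)` generated by
the class of `g`. -/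
def cyclicCode {F : Type*} [Field F] (n : ℕ) (g : F[X]) : Submodule F (Fin n → F) where
  carrier := {c | AdjoinRoot.mk (X ^ n - 1 : F[X]) (∑ i : Fin n, C (c i) * X ^ (i : ℕ)) ∈
    Ideal.span {AdjoinRoot.mk (X ^ n - 1 : F[X]) g}}
  add_mem' {a b} ha hb := by
    simp only [Set.mem_ofPred_eq, Pi.add_apply, C_add, add_mul, Finset.sum_add_distrib,
      map_add (AdjoinRoot.mk (X ^ n - 1 : F[X]))] at *
    exact Ideal.add_mem _ ha hb
  zero_mem' := by simp
  smul_mem' a c hc := by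
    simp only [Set.mem_ofPred_eq, Pi.smul_apply, smul_eq_mul, C_mul, mul_assoc,
      ← Finset.mul_sum, map_mul (AdjoinRoot.mk (X ^ n - 1 : F[X]))] at *
    exact Ideal.mul_mem_left _ _ hc

open Classical in
/-- The generator polynomial `lcm (M_{β^h}, M_{β^(h+1)}, …, M_{β^(h+δ-2)})` over `F`, where
`M_x` is the minimal polynomial of `x` over `F`. -/
def bchGenerator (F : Type*) {K : Type*} [Field F] [Field K] [Algebra F K]
    (β : K) (δ h : ℕ) : F[X] :=
  letI : NormalizedGCDMonoid F[X] := UniqueFactorizationMonoid.toNormalizedGCDMonoid F[X]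
  (Finset.range (δ - 1)).lcm fun j => minpoly F (β ^ (h + j))

/-- The BCH code `C_(q,n,δ,h)` over `F`, `q = |F|`, with respect to a primitive `n`-th root of
unity `β` in an extension field of `F`. -/
def bchCode (F : Type*) {K : Type*} [Field F] [Field K] [Algebra F K]
    (β : K) (n δ h : ℕ) : Submodule F (Fin n → F) :=
  cyclicCode n (bchGenerator F β δ h)

/-- The dual of a linear code with respect to the standard inner product. -/
def dualCode {F : Type*} [Field F] {n : ℕ} (C : Submodule F (Fin n → F)) :
    Submodule F (Fin n → F) where
  carrier := {v | ∀ c ∈ C, c ⬝ᵥ v = 0}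
  add_mem' {a b} ha hb c hc := by rw [dotProduct_add, ha c hc, hb c hc, add_zero]
  zero_mem' c _ := dotProduct_zero c
  smul_mem' a v hv c hc := by rw [dotProduct_smul, hv c hc, smul_zero]

open Classical in
/-- `d` is the minimum distance of the code: the least Hamming weight of a nonzero codeword
(in particular there is a nonzero codeword). -/
def IsMinDist {F : Type*} [Field F] {n : ℕ} (C : Submodule F (Fin n → F)) (d : ℕ) : Prop :=
  IsLeast {w | ∃ c ∈ C, c ≠ 0 ∧ hammingNorm c = w} d

/-- The code, of length `n`, has parameters `[n, k, d]`. -/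
def HasParameters {F : Type*} [Field F] {n : ℕ} (C : Submodule F (Fin n → F)) (k d : ℕ) : Prop :=
  Module.finrank F C = k ∧ IsMinDist C d

/-- Almost MDS: parameters `[n, k, n - k]`. -/
def IsAMDS {F : Type*} [Field F] {n : ℕ} (C : Submodule F (Fin n → F)) : Prop :=
  ∃ k d : ℕ, HasParameters C k d ∧ k + d = n

/-- Near MDS: the code and its dual are both almost MDS. -/
def IsNMDS {F : Type*} [Field F] {n : ℕ} (C : Submodule F (Fin n → F)) : Prop :=
  IsAMDS C ∧ IsAMDS (dualCode C)

end

/-! ### Cyclic codes: divisibility, dimension and duality -/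

section Words

variable {F : Type*} [Field F] {n : ℕ}

/-! Write `q = 3 ^ s`. On the `(q+1)`-th roots of unity `x = β ^ i` the Frobenius `x ↦ x ^ q` is
inversion, so the code has exactly the zeros `β ^ (±4)`, `β ^ (±5)`, and its dimension is `q - 3`.
Its parity-check columns over `K` are `x⁻⁵ (1, x, x⁹, x¹⁰)`.

Any three columns are independent because `(X - y)(X⁹ - z⁹)` separates one point from two others
(`four_le_card_support`).

By duality, a dual word vanishes at `x` exactly when `x⁹ (c x + d) = a x + b` for fixed
coefficients. If this Möbius map is invertible, iterating it `(s+1)/2` times expresses `x ^ (3q) =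
x⁻³` as a Möbius function of `x`, a quartic equation; the degenerate case factors. So there are at
most four zeros (`card_le_four`).

Both bounds are attained by explicit words built from the fourth root of unity `β ^ m`, where `q + 1
= 4m`. -/

theorem coeff_sum_C_mul_X_pow (c : Fin n → F) (i : Fin n) :
    (∑ j : Fin n, C (c j) * X ^ (j : ℕ)).coeff i = c i := by
  simp [coeff_C_mul, coeff_X_pow, Fin.val_inj]

theorem degree_sum_C_mul_X_pow_lt (c : Fin n → F) :
    (∑ j : Fin n, C (c j) * X ^ (j : ℕ)).degree < (n : WithBot ℕ) :=
  degree_sum_fin_lt c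

theorem sum_C_coeff_mul_X_pow {p : F[X]} (hp : p.degree < n) :
    ∑ j : Fin n, C (p.coeff j) * X ^ (j : ℕ) = p := by
  ext k
  by_cases hk : k < n
  · exact coeff_sum_C_mul_X_pow (fun j => p.coeff j) ⟨k, hk⟩
  · rw [coeff_eq_zero_of_degree_lt, coeff_eq_zero_of_degree_lt]
    · exact hp.trans_le (by exact_mod_cast not_lt.1 hk)
    · exact (degree_sum_C_mul_X_pow_lt _).trans_le (by exact_mod_cast not_lt.1 hk)

theorem mem_cyclicCode_iff_dvd {g : F[X]} (hg : g ∣ X ^ n - 1) (c : Fin n → F) :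
    c ∈ cyclicCode n g ↔ g ∣ ∑ i : Fin n, C (c i) * X ^ (i : ℕ) := by
  change AdjoinRoot.mk (X ^ n - 1 : F[X]) _ ∈ Ideal.span {AdjoinRoot.mk (X ^ n - 1 : F[X]) g} ↔ _
  rw [Ideal.mem_span_singleton]
  constructor
  · rintro ⟨y, hy⟩
    obtain ⟨h, rfl⟩ := AdjoinRoot.mk_surjective y
    rw [← map_mul, AdjoinRoot.mk_eq_mk] at hy
    simpa using (hg.trans hy).add (dvd_mul_right g h)
  · exact fun h => map_dvd _ h

theorem bchGenerator_dvd_iff {K : Type*} [Field K] [Algebra F K] (β : K) (δ h : ℕ) (p : F[X]) :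
    bchGenerator F β δ h ∣ p ↔ ∀ j < δ - 1, aeval (β ^ (h + j)) p = 0 := by
  simp [bchGenerator, Finset.lcm_dvd_iff, minpoly.dvd_iff]

theorem mem_bchCode_iff {K : Type*} [Field K] [Algebra F K] {β : K} (hβ : β ^ n = 1)
    (δ h : ℕ) (c : Fin n → F) :
    c ∈ bchCode F β n δ h ↔
      ∀ j < δ - 1, aeval (β ^ (h + j)) (∑ i : Fin n, C (c i) * X ^ (i : ℕ)) = 0 := by
  rw [← bchGenerator_dvd_iff]
  refine mem_cyclicCode_iff_dvd ((bchGenerator_dvd_iff β δ h _).2 fun j _ => ?_) c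
  simp [← pow_mul, mul_comm _ n, pow_mul β n, hβ]

/-- Multiplication by `g` identifies the polynomials of degree below `n - deg g` with the code. -/
theorem finrank_of_mem_iff_dvd (C' : Submodule F (Fin n → F)) {g : F[X]} (hg : g.Monic)
    (hgn : g.natDegree ≤ n)
    (hC : ∀ c, c ∈ C' ↔ g ∣ ∑ i : Fin n, C (c i) * X ^ (i : ℕ)) :
    Module.finrank F C' = n - g.natDegree := by
  have hdeg : ∀ h : F[X], (g * h).degree < n ↔ h.degree < (n - g.natDegree : ℕ) := by
    intro h
    by_cases h0 : h = 0
    · simp [h0]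
    have : g * h ≠ 0 := mul_ne_zero hg.ne_zero h0
    rw [← natDegree_lt_iff_degree_lt this, ← natDegree_lt_iff_degree_lt h0,
      natDegree_mul hg.ne_zero h0]
    omega
  let Φ : degreeLT F (n - g.natDegree) →ₗ[F] (Fin n → F) :=
    LinearMap.pi fun i => lcoeff F i ∘ₗ LinearMap.mulLeft F g ∘ₗ Submodule.subtype _
  have hΦ : ∀ h, ∑ i : Fin n, C (Φ h i) * X ^ (i : ℕ) = g * h := fun h =>
    sum_C_coeff_mul_X_pow ((hdeg _).2 (mem_degreeLT.1 h.2))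
  have hinj : Function.Injective Φ := by
    rw [← LinearMap.ker_eq_bot, LinearMap.ker_eq_bot']
    intro h hh
    have := hΦ h
    simp only [hh, Pi.zero_apply, C_0, zero_mul, Finset.sum_const_zero] at this
    have := (mul_eq_zero.1 this.symm).resolve_left hg.ne_zero
    exact Subtype.ext this
  have hrange : LinearMap.range Φ = C' := by
    ext c
    rw [hC]
    constructor
    · rintro ⟨h, rfl⟩
      exact ⟨h, hΦ h⟩
    · rintro ⟨h, hh⟩
      have hlt := degree_sum_C_mul_X_pow_lt c
      rw [hh, hdeg] at hlt
      refine ⟨⟨h, mem_degreeLT.2 hlt⟩, funext fun i => ?_⟩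
      change (g * h).coeff i = c i
      rw [← hh, coeff_sum_C_mul_X_pow]
  rw [← hrange, LinearMap.finrank_range_of_inj hinj,
    (degreeLTEquiv F _).finrank_eq, Module.finrank_fin_fun]

theorem finrank_add_finrank_dualCode (C' : Submodule F (Fin n → F)) :
    Module.finrank F C' + Module.finrank F (dualCode C') = n := by
  have h1 : (C'.map (dotProductEquiv F (Fin n)).toLinearMap).dualCoannihilator = dualCode C' := by
    ext v
    simp only [Submodule.mem_dualCoannihilator, Submodule.mem_map]
    constructor
    · intro h c hc
      exact h _ ⟨c, hc, rfl⟩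
    · rintro h _ ⟨c, hc, rfl⟩
      exact h c hc
  have h2 := Subspace.finrank_add_finrank_dualCoannihilator_eq
    (C'.map (dotProductEquiv F (Fin n)).toLinearMap)
  rw [h1, LinearEquiv.finrank_map_eq, Module.finrank_fin_fun] at h2
  exact h2

/-- A word orthogonal to all multiples of `g` is, over an extension field where `g` splits with
distinct roots, a combination of the words `(1, x, x ^ 2, …)` for `x` a root of `g`. -/
theorem exists_sum_mul_pow_of_dotProduct_eq_zero {K : Type*} [Field K] [Algebra F K]
    {g : F[X]} (r : Finset K) (hr : g.map (algebraMap F K) = ∏ x ∈ r, (X - C x))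
    (v : Fin n → F)
    (hv : ∀ c : Fin n → F, g ∣ ∑ i : Fin n, C (c i) * X ^ (i : ℕ) → c ⬝ᵥ v = 0) :
    ∃ a : K → K, ∀ i, algebraMap F K (v i) = ∑ x ∈ r, a x * x ^ (i : ℕ) := by
  classical
  let ψ : (Fin n → K) →ₗ[K] K := ∑ i, (algebraMap F K (v i)) • LinearMap.proj i
  have hψ : ∀ c, ψ c = ∑ i, algebraMap F K (v i) * c i := by intro c; simp [ψ, Algebra.smul_def]
  let ev : r → (Fin n → K) →ₗ[K] K := fun x => ∑ i : Fin n, ((x : K) ^ (i : ℕ)) • LinearMap.proj i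
  have hev : ∀ x c, ev x c = ∑ i : Fin n, (x : K) ^ (i : ℕ) * c i := by intro x c; simp [ev]
  have hker : ⨅ x, LinearMap.ker (ev x) ≤ LinearMap.ker ψ := by
    intro c hc
    simp only [Submodule.mem_iInf, LinearMap.mem_ker, hev] at hc
    rw [LinearMap.mem_ker, hψ]
    have hdvd : g.map (algebraMap F K) ∣ ∑ i : Fin n, C (c i) * X ^ (i : ℕ) := by
      rw [hr]
      refine Finset.prod_dvd_of_coprime (fun x _ y _ hxy => ?_) fun x hx => ?_
      · exact isCoprime_X_sub_C_of_isUnit_sub (sub_ne_zero.2 hxy).isUnit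
      · rw [dvd_iff_isRoot, IsRoot.def, eval_finsetSum]
        refine (Finset.sum_congr rfl fun i _ => ?_).trans (hc ⟨x, hx⟩)
        rw [eval_C_mul, eval_X_pow, mul_comm]
    have hg : (g.map (algebraMap F K)).Monic := hr ▸ monic_prod_X_sub_C _ _
    have hg' : g.Monic := monic_map_iff.1 hg
    obtain ⟨h, hh⟩ := hdvd
    by_cases h0 : h = 0
    · have : ∀ i, c i = 0 := fun i => by
        rw [← coeff_sum_C_mul_X_pow c i, hh, h0, mul_zero, coeff_zero]
      simp [this]
    have hlt := degree_sum_C_mul_X_pow_lt c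
    rw [hh, ← natDegree_lt_iff_degree_lt (mul_ne_zero hg.ne_zero h0),
      natDegree_mul hg.ne_zero h0, natDegree_map] at hlt
    -- A word over `K` divisible by `g` is a `K`-combination of the shifts `g * X ^ k`. These have
    -- coefficients in `F`, so `hv` applies to each.
    have hc' : ∀ i : Fin n, c i = ∑ k ∈ Finset.range (h.natDegree + 1),
        h.coeff k * algebraMap F K ((g * X ^ k).coeff i) := by
      intro i
      rw [← coeff_sum_C_mul_X_pow c i, hh]
      conv_lhs => rw [h.as_sum_range_C_mul_X_pow, Finset.mul_sum, finsetSum_coeff]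
      refine Finset.sum_congr rfl fun k _ => ?_
      rw [← coeff_map (algebraMap F K), Polynomial.map_mul, Polynomial.map_pow, map_X, mul_left_comm, coeff_C_mul]
    simp only [hc', Finset.mul_sum]
    rw [Finset.sum_comm]
    refine Finset.sum_eq_zero fun k hk => ?_
    have hk' : (g * X ^ k).degree < (n : WithBot ℕ) := by
      rw [← natDegree_lt_iff_degree_lt (mul_ne_zero hg'.ne_zero (pow_ne_zero _ X_ne_zero)),
        natDegree_mul hg'.ne_zero (pow_ne_zero _ X_ne_zero), natDegree_X_pow]
      have := Finset.mem_range.1 hk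
      omega
    have := hv (fun i => (g * X ^ k).coeff i) (by
      rw [sum_C_coeff_mul_X_pow hk']; exact dvd_mul_right _ _)
    have := congrArg (algebraMap F K) this
    simp only [dotProduct, map_sum, map_mul, map_zero] at this
    rw [← mul_zero (h.coeff k), ← this, Finset.mul_sum]
    exact Finset.sum_congr rfl fun i _ => by ring
  -- A functional vanishing on the common kernel of the evaluations lies in their span.
  obtain ⟨a, ha⟩ := (Submodule.mem_span_range_iff_exists_fun K).1
    (mem_span_of_iInf_ker_le_ker hker)
  refine ⟨fun x => if h : x ∈ r then a ⟨x, h⟩ else 0, fun i => ?_⟩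
  have := LinearMap.congr_fun ha (Pi.single i 1)
  simp only [LinearMap.sum_apply, LinearMap.smul_apply, hev, hψ, smul_eq_mul] at this
  rw [← Finset.sum_coe_sort]
  simpa [Pi.single_apply] using this.symm

end Words

/-! ### Equations between `x ^ 9` and `x` in characteristic three -/

section CharThree

variable {K : Type*} [Field K] [CharP K 3]

theorem add_pow_nine (x y : K) : (x + y) ^ 9 = x ^ 9 + y ^ 9 :=
  have : ExpChar K 3 := .prime Nat.prime_three
  add_pow_expChar_pow (n := 2) (p := 3) x y

theorem sub_pow_nine (x y : K) : (x - y) ^ 9 = x ^ 9 - y ^ 9 :=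
  have : ExpChar K 3 := .prime Nat.prime_three
  sub_pow_expChar_pow (n := 2) (p := 3) x y

theorem pow_nine_injective : Function.Injective fun x : K => x ^ 9 := fun x y h => by
  have h' : (x - y) ^ 9 = 0 := by rw [sub_pow_nine, sub_eq_zero]; exact h
  exact sub_eq_zero.1 (pow_eq_zero_iff (by norm_num) |>.1 h')

/-- If `x ^ 9` is the image of `x` under a fixed Möbius transformation, so is `x ^ 9 ^ k`. -/
theorem exists_pow_nine_pow_mul_eq {a b c d : K} (hdet : a * d - b * c ≠ 0) {S : Set K}
    (hS : ∀ x ∈ S, x ^ 9 * (c * x + d) = a * x + b) (k : ℕ) :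
    ∃ a' b' c' d' : K, a' * d' - b' * c' ≠ 0 ∧
      ∀ x ∈ S, x ^ 9 ^ k * (c' * x + d') = a' * x + b' := by
  induction k with
  | zero => exact ⟨1, 0, 0, 1, by simp, fun x _ => by simp⟩
  | succ k ih =>
    obtain ⟨a', b', c', d', hdet', h⟩ := ih
    refine ⟨a' ^ 9 * a + b' ^ 9 * c, a' ^ 9 * b + b' ^ 9 * d, c' ^ 9 * a + d' ^ 9 * c,
      c' ^ 9 * b + d' ^ 9 * d, ?_, fun x hx => ?_⟩
    -- The new determinant is the ninth power of the old one times `a * d - b * c`.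
    · have h1 := sub_pow_nine (a' * d') (b' * c')
      have h2 := mul_ne_zero (pow_ne_zero 9 hdet') hdet
      rw [h1] at h2
      convert h2 using 1
      ring
    · have h1 := congrArg (· ^ 9) (h x hx)
      simp only [mul_pow, add_pow_nine, ← pow_mul, ← pow_succ] at h1
      have h2 := hS x hx
      linear_combination (c * x + d) * h1 - (x ^ 9 ^ (k + 1) * c' ^ 9 - a' ^ 9) * h2

/-- With `s = 2k + 1`, `9 ^ (k+1) = 3 * 3 ^ s`, so the iterate sends `x` to `x⁻³`. Clearing
denominators gives a quartic; it is nonzero because the iterated Möbius map still has nonzero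
determinant. -/
theorem card_le_four_of_det_ne_zero {s : ℕ} (hs : Odd s) {a b c d : K}
    (hdet : a * d - b * c ≠ 0) (S : Finset K) (hU : ∀ x ∈ S, x ^ (3 ^ s + 1) = 1)
    (hS : ∀ x ∈ S, x ^ 9 * (c * x + d) = a * x + b) : S.card ≤ 4 := by
  obtain ⟨k, hk⟩ := hs
  obtain ⟨a', b', c', d', hdet', h⟩ := exists_pow_nine_pow_mul_eq hdet (S := S) hS (k + 1)
  have hpow : 9 ^ (k + 1) = 3 ^ s * 3 := by
    rw [hk, ← pow_succ, show (9 : ℕ) = 3 ^ 2 by norm_num, ← pow_mul]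
    ring_nf
  let P : K[X] := C a' * X ^ 4 + C b' * X ^ 3 - C c' * X - C d'
  have hP0 : P ≠ 0 := by
    intro h0
    have h3 : ∀ i, P.coeff i = 0 := by simp [h0]
    have ha := h3 4
    have hc := h3 1
    simp [P, coeff_C] at ha hc
    simp [ha, hc] at hdet'
  have hdeg : P.natDegree ≤ 4 := by simp only [P]; compute_degree
  refine (card_le_degree_of_subset_roots (p := P) fun x hx => ?_).trans hdeg
  rw [mem_roots hP0, IsRoot.def]
  have h1 := h x hx
  have h2 : (x ^ 3 ^ s) ^ 3 * x ^ 3 = 1 := by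
    rw [← mul_pow, ← pow_succ, hU x hx, one_pow]
  rw [hpow, pow_mul] at h1
  simp only [P, eval_sub, eval_add, eval_mul, eval_C, eval_pow, eval_X]
  linear_combination (c' * x + d') * h2 - x ^ 3 * h1

/-- Unless `c = d = 0`, the rows satisfy `(a, b) = t (c, d)` and the equation becomes `(x⁹ - t)(c x
+ d) = 0`; each factor has at most one root. -/
theorem card_le_two_of_det_eq_zero {a b c d : K} (hdet : a * d - b * c = 0)
    (h0 : ¬(a = 0 ∧ b = 0 ∧ c = 0 ∧ d = 0)) (S : Finset K)
    (hS : ∀ x ∈ S, x ^ 9 * (c * x + d) = a * x + b) : S.card ≤ 2 := by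
  classical
  have hlin : ∀ {c d : K}, ¬(c = 0 ∧ d = 0) → (S.filter fun x => c * x + d = 0).card ≤ 1 := by
    intro c d hcd
    refine Finset.card_le_one.2 fun x hx y hy => ?_
    have hx := (Finset.mem_filter.1 hx).2
    have hy := (Finset.mem_filter.1 hy).2
    by_contra hxy
    have hc : c = 0 := by
      refine (mul_eq_zero.1 (?_ : c * (x - y) = 0)).resolve_right (sub_ne_zero.2 hxy)
      linear_combination hx - hy
    exact hcd ⟨hc, by simpa [hc] using hx⟩
  by_cases hcd : c = 0 ∧ d = 0
  · have hab : ¬(a = 0 ∧ b = 0) := fun h => h0 ⟨h.1, h.2, hcd⟩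
    rw [← Finset.filter_true_of_mem (s := S) (p := fun x => a * x + b = 0) fun x hx => by
      rw [← hS x hx, hcd.1, hcd.2]; ring]
    exact (hlin hab).trans one_le_two
  · obtain ⟨t, hta, htb⟩ : ∃ t, a = t * c ∧ b = t * d := by
      by_cases hc : c = 0
      · have hd : d ≠ 0 := fun hd => hcd ⟨hc, hd⟩
        refine ⟨b / d, ?_, by field_simp⟩
        field_simp
        linear_combination hdet
      · refine ⟨a / c, by field_simp, ?_⟩
        field_simp
        linear_combination -hdet
    have h9 : (S.filter fun x => x ^ 9 = t).card ≤ 1 := Finset.card_le_one.2 fun x hx y hy =>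
      pow_nine_injective ((Finset.mem_filter.1 hx).2.trans (Finset.mem_filter.1 hy).2.symm)
    have hsub : S ⊆ (S.filter fun x => x ^ 9 = t) ∪ S.filter fun x => c * x + d = 0 := by
      intro x hx
      have h : (x ^ 9 - t) * (c * x + d) = 0 := by
        rw [sub_mul, hS x hx, hta, htb]; ring
      rcases mul_eq_zero.1 h with h | h
      · exact Finset.mem_union_left _ (Finset.mem_filter.2 ⟨hx, sub_eq_zero.1 h⟩)
      · exact Finset.mem_union_right _ (Finset.mem_filter.2 ⟨hx, h⟩)
    have := (Finset.card_le_card hsub).trans (Finset.card_union_le _ _)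
    have := hlin hcd
    omega

/-- For `s` odd, a nonzero equation `x ^ 9 (c x + d) = a x + b` has at most four solutions among
the `(3 ^ s + 1)`-th roots of unity. -/
theorem card_le_four {s : ℕ} (hs : Odd s) {a b c d : K}
    (h0 : ¬(a = 0 ∧ b = 0 ∧ c = 0 ∧ d = 0)) (S : Finset K)
    (hU : ∀ x ∈ S, x ^ (3 ^ s + 1) = 1)
    (hS : ∀ x ∈ S, x ^ 9 * (c * x + d) = a * x + b) : S.card ≤ 4 := by
  by_cases hdet : a * d - b * c = 0
  · exact (card_le_two_of_det_eq_zero hdet h0 S hS).trans (by norm_num)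
  · exact card_le_four_of_det_ne_zero hs hdet S hU hS

open Classical in
/-- Any three distinct points of the form `(1, x, x ^ 9, x ^ 10)` are linearly independent. -/
theorem four_le_card_support {ι : Type*} [Fintype ι] {x w : ι → K} (hx : Function.Injective x)
    (hw : w ≠ 0) (h0 : ∑ i, w i = 0) (h1 : ∑ i, w i * x i = 0) (h9 : ∑ i, w i * x i ^ 9 = 0)
    (h10 : ∑ i, w i * x i ^ 10 = 0) : 4 ≤ (Finset.univ.filter fun i => w i ≠ 0).card := by
  by_contra! hlt
  obtain ⟨k, hk⟩ := Function.ne_iff.1 hw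
  have hkm : k ∈ Finset.univ.filter fun i => w i ≠ 0 := by simpa using hk
  set T := (Finset.univ.filter fun i => w i ≠ 0).erase k with hT
  have hTcard : T.card ≤ 2 := by
    rw [hT, Finset.card_erase_of_mem hkm]; omega
  have hkT : k ∉ T := Finset.notMem_erase _ _
  -- `y` and `z` cover the support points other than `x k`; with fewer than two such points they
  -- coincide, and `x k + 1` is a dummy value.
  have hTx : ∃ y z, (∀ i ∈ T, x i = y ∨ x i = z) ∧ x k ≠ y ∧ x k ≠ z := by
    have hne : ∀ i ∈ T, x k ≠ x i := fun i hi h => hkT (hx h ▸ hi)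
    rcases Nat.lt_or_ge T.card 1 with h | h
    · have : T = ∅ := Finset.card_eq_zero.1 (by omega)
      exact ⟨x k + 1, x k + 1, by simp [this], by simp, by simp⟩
    rcases Nat.lt_or_ge T.card 2 with h | h
    · obtain ⟨i, hi⟩ := Finset.card_eq_one.1 (by omega : T.card = 1)
      rw [hi] at hne ⊢
      exact ⟨x i, x i, by simp, hne i (by simp), hne i (by simp)⟩
    · obtain ⟨i, j, -, hij⟩ := Finset.card_eq_two.1 (by omega : T.card = 2)
      rw [hij] at hne ⊢
      exact ⟨x i, x j, by simp, hne i (by simp), hne j (by simp)⟩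
  obtain ⟨y, z, hyz, hky, hkz⟩ := hTx
  -- `(X - y)(X⁹ - z⁹)` is a combination of `1, X, X⁹, X¹⁰`, so all four relations combine; only the
  -- term at `k` survives.
  have hsum : ∑ i, w i * ((x i - y) * (x i ^ 9 - z ^ 9)) = 0 := by
    have : ∀ i, w i * ((x i - y) * (x i ^ 9 - z ^ 9)) =
        w i * x i ^ 10 - y * (w i * x i ^ 9) - z ^ 9 * (w i * x i) + y * z ^ 9 * w i :=
      fun i => by ring
    simp only [this, Finset.sum_add_distrib, Finset.sum_sub_distrib, ← Finset.mul_sum, h0, h1, h9,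
      h10]
    ring
  rw [Finset.sum_eq_single k] at hsum
  · refine mul_ne_zero hk (mul_ne_zero (sub_ne_zero.2 hky) (sub_ne_zero.2 fun h => ?_)) hsum
    exact hkz (pow_nine_injective h)
  · intro i _ hik
    by_cases hwi : w i = 0
    · rw [hwi, zero_mul]
    · rcases hyz i (by simp [hT, hik, hwi]) with h | h <;> simp [h]
  · simp

end CharThree

/-! ### Frobenius and descent from `K` to `F` -/

section FixedField

variable {F : Type*} [Field F] [Finite F] {K : Type*} [Field K] [Algebra F K]

/-- `X ^ q - X` already has `q` roots in `F`, so it acquires none in `K`. -/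
theorem exists_algebraMap_eq_of_pow_card_eq {x : K} (hx : x ^ Nat.card F = x) :
    ∃ a : F, algebraMap F K a = x := by
  have := Fintype.ofFinite F
  rw [Nat.card_eq_fintype_card] at hx
  have hne := FiniteField.X_pow_card_sub_X_ne_zero F (Fintype.one_lt_card (α := F))
  have hroots := roots_map_of_injective_of_card_eq_natDegree
    (p := (X ^ Fintype.card F - X : F[X])) (algebraMap F K).injective
    (by rw [FiniteField.roots_X_pow_card_sub_X,
      FiniteField.X_pow_card_sub_X_natDegree_eq F Fintype.one_lt_card]; rfl)
  have hmem : x ∈ ((X ^ Fintype.card F - X : F[X]).map (algebraMap F K)).roots := by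
    rw [mem_roots (Polynomial.map_ne_zero hne)]
    simp [hx]
  rw [← hroots, Multiset.mem_map] at hmem
  obtain ⟨a, -, ha⟩ := hmem
  exact ⟨a, ha⟩

theorem aeval_pow_card_eq_zero {x : K} {p : F[X]} (hx : aeval x p = 0) :
    aeval (x ^ Nat.card F) p = 0 := by
  have := Fintype.ofFinite F
  rw [Nat.card_eq_fintype_card]
  have h := aeval_algHom_apply (FiniteField.frobeniusAlgHom F K) x p
  rw [hx, map_zero] at h
  exact h

theorem sub_pow_natCard (x y : K) :
    (x - y) ^ Nat.card F = x ^ Nat.card F - y ^ Nat.card F := by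
  have := Fintype.ofFinite F
  rw [Nat.card_eq_fintype_card]
  exact map_sub (FiniteField.frobeniusAlgHom F K) x y

theorem add_pow_natCard (x y : K) :
    (x + y) ^ Nat.card F = x ^ Nat.card F + y ^ Nat.card F := by
  have := Fintype.ofFinite F
  rw [Nat.card_eq_fintype_card]
  exact map_add (FiniteField.frobeniusAlgHom F K) x y

theorem charP_of_natCard_eq_three_pow {s : ℕ} (hF : Nat.card F = 3 ^ s) : CharP K 3 := by
  have := Fintype.ofFinite F
  have : Fact (Nat.Prime 3) := ⟨Nat.prime_three⟩
  have : CharP F 3 := charP_of_card_eq_prime_pow (f := s) (by rw [← hF, Nat.card_eq_fintype_card])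
  exact charP_of_injective_algebraMap' F 3

end FixedField

/-! ### Weights and arithmetic of `3 ^ s + 1` -/

section MinDist

variable {F : Type*} [Field F] {n : ℕ}

open Classical in
theorem isMinDist_of_le {C' : Submodule F (Fin n → F)} {d : ℕ}
    (h : ∃ c ∈ C', c ≠ 0 ∧ (Finset.univ.filter fun i => c i ≠ 0).card ≤ d)
    (h' : ∀ c ∈ C', c ≠ 0 → d ≤ (Finset.univ.filter fun i => c i ≠ 0).card) :
    IsMinDist C' d := by
  obtain ⟨c, hc, hc0, hcd⟩ := h
  refine ⟨⟨c, hc, hc0, le_antisymm hcd (h' c hc hc0)⟩, ?_⟩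
  rintro w ⟨c, hc, hc0, rfl⟩
  exact h' c hc hc0

open Classical in
theorem card_filter_ne_zero (c : Fin n → F) :
    (Finset.univ.filter fun i => c i ≠ 0).card =
      n - (Finset.univ.filter fun i => c i = 0).card := by
  have := Finset.card_filter_add_card_filter_not (s := Finset.univ) fun i => c i = 0
  rw [Finset.card_fin] at this
  exact Nat.eq_sub_of_add_eq' this

end MinDist

theorem exists_three_pow_add_one_eq {s : ℕ} (hs : Odd s) : ∃ m, Odd m ∧ 3 ^ s + 1 = 4 * m := by
  obtain ⟨k, rfl⟩ := hs
  have h : 3 ^ (2 * k + 1) % 8 = 3 := by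
    rw [pow_succ, pow_mul, Nat.mul_mod, Nat.pow_mod]
    norm_num
  generalize 3 ^ (2 * k + 1) = q at h
  exact ⟨(q + 1) / 4, Nat.odd_iff.2 (by omega), by omega⟩

theorem twenty_seven_le_three_pow {s : ℕ} (hs : Odd s) (hs1 : 1 < s) : 27 ≤ 3 ^ s := by
  have h : 3 ≤ s := by obtain ⟨k, rfl⟩ := hs; omega
  exact Nat.pow_le_pow_right (n := 3) (by norm_num) h

/-! ### Zeros of the code, dimensions and weight lower bounds -/

section Generator

variable {s : ℕ} {F : Type*} [Field F] {K : Type*} [Field K] [Algebra F K] {β : K}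

theorem pow_three_pow_eq_inv {x : K} (hx : x ^ (3 ^ s + 1) = 1) : x ^ 3 ^ s = x⁻¹ :=
  eq_inv_of_mul_eq_one_left (by rw [← pow_succ, hx])

theorem pow_pow_three_pow_add_one (hβ : IsPrimitiveRoot β (3 ^ s + 1)) (j : ℕ) :
    (β ^ j) ^ (3 ^ s + 1) = 1 := by
  rw [← pow_mul, mul_comm, pow_mul, hβ.pow_eq_one, one_pow]

/-- The quadratic polynomial over `F` with roots `x` and its inverse. -/
theorem exists_quadratic [Finite F] (hF : Nat.card F = 3 ^ s) {x : K}
    (hx : x ^ (3 ^ s + 1) = 1) :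
    ∃ p : F[X], p.Monic ∧ p.natDegree = 2 ∧
      p.map (algebraMap F K) = (X - C x) * (X - C x⁻¹) := by
  have hx0 : x ≠ 0 := by rintro rfl; simp at hx
  obtain ⟨t, ht⟩ : ∃ t : F, algebraMap F K t = x + x⁻¹ := by
    apply exists_algebraMap_eq_of_pow_card_eq
    rw [add_pow_natCard, hF, inv_pow, pow_three_pow_eq_inv hx, inv_inv, add_comm]
  have hC : (C x * C x⁻¹ : K[X]) = 1 := by rw [← C_mul, mul_inv_cancel₀ hx0, C_1]
  have hdeg : (X ^ 2 - C t * X + 1 : F[X]).natDegree = 2 := by compute_degree!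
  refine ⟨X ^ 2 - C t * X + 1, ?_, hdeg, ?_⟩
  · rw [Monic, leadingCoeff, hdeg]
    simp [coeff_one]
  · simp only [Polynomial.map_add, Polynomial.map_sub, Polynomial.map_mul, Polynomial.map_pow,
      map_X, map_C, ht, Polynomial.map_one, C_add]
    linear_combination -hC

variable (β) in
open Classical in
/-- The zeros `β ^ 4`, `β ^ 5` and their inverses. -/
noncomputable def zeroSet : Finset K := {β ^ 4, β ^ 5, (β ^ 4)⁻¹, (β ^ 5)⁻¹}

/-- The bound `27 ≤ 3 ^ s` puts the order of `β` above 10, the largest exponent needed to tell the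
four zeros apart. -/
theorem pow_ne_one_of_le_ten (hβ : IsPrimitiveRoot β (3 ^ s + 1)) (h27 : 27 ≤ 3 ^ s) {j : ℕ}
    (hj : j ≠ 0) (hj10 : j ≤ 10) : β ^ j ≠ 1 :=
  hβ.pow_ne_one_of_pos_of_lt hj (by omega)

theorem zeroSet_distinct (hβ : IsPrimitiveRoot β (3 ^ s + 1)) (h27 : 27 ≤ 3 ^ s) :
    (β ^ 4 ≠ β ^ 5 ∧ β ^ 4 ≠ (β ^ 4)⁻¹ ∧ β ^ 4 ≠ (β ^ 5)⁻¹) ∧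
      (β ^ 5 ≠ (β ^ 4)⁻¹ ∧ β ^ 5 ≠ (β ^ 5)⁻¹) ∧ (β ^ 4)⁻¹ ≠ (β ^ 5)⁻¹ := by
  have hβ0 : β ≠ 0 := hβ.ne_zero (by omega)
  have h45 : β ^ 4 ≠ β ^ 5 := fun h =>
    pow_ne_one_of_le_ten hβ h27 one_ne_zero (by norm_num)
      (mul_left_cancel₀ (pow_ne_zero 4 hβ0) (by linear_combination -h))
  have hinv : ∀ {i j : ℕ}, i + j ≠ 0 → i + j ≤ 10 → β ^ i ≠ (β ^ j)⁻¹ := fun {i j} h h' he =>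
    pow_ne_one_of_le_ten hβ h27 h h' (by
      rw [pow_add, he, inv_mul_cancel₀ (pow_ne_zero _ hβ0)])
  exact ⟨⟨h45, hinv (by norm_num) (by norm_num), hinv (by norm_num) (by norm_num)⟩,
    ⟨hinv (by norm_num) (by norm_num), hinv (by norm_num) (by norm_num)⟩,
    fun h => h45 (inv_injective h)⟩

theorem sum_zeroSet (hβ : IsPrimitiveRoot β (3 ^ s + 1)) (h27 : 27 ≤ 3 ^ s) (f : K → K) :
    ∑ x ∈ zeroSet β, f x = f (β ^ 4) + (f (β ^ 5) + (f (β ^ 4)⁻¹ + f (β ^ 5)⁻¹)) := by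
  classical
  obtain ⟨⟨h1, h2, h3⟩, ⟨h4, h5⟩, h6⟩ := zeroSet_distinct hβ h27
  rw [zeroSet, Finset.sum_insert (by simp only [Finset.mem_insert, Finset.mem_singleton]; tauto),
    Finset.sum_insert (by simp only [Finset.mem_insert, Finset.mem_singleton]; tauto),
    Finset.sum_insert (by simpa only [Finset.mem_singleton] using h6), Finset.sum_singleton]

theorem prod_zeroSet (hβ : IsPrimitiveRoot β (3 ^ s + 1)) (h27 : 27 ≤ 3 ^ s) (f : K → K[X]) :
    ∏ x ∈ zeroSet β, f x = f (β ^ 4) * (f (β ^ 5) * (f (β ^ 4)⁻¹ * f (β ^ 5)⁻¹)) := by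
  classical
  obtain ⟨⟨h1, h2, h3⟩, ⟨h4, h5⟩, h6⟩ := zeroSet_distinct hβ h27
  rw [zeroSet, Finset.prod_insert (by simp only [Finset.mem_insert, Finset.mem_singleton]; tauto),
    Finset.prod_insert (by simp only [Finset.mem_insert, Finset.mem_singleton]; tauto),
    Finset.prod_insert (by simpa only [Finset.mem_singleton] using h6), Finset.prod_singleton]

theorem aeval_inv_eq_zero [Finite F] (hF : Nat.card F = 3 ^ s) {x : K}
    (hx : x ^ (3 ^ s + 1) = 1) {p : F[X]} (hp : aeval x p = 0) : aeval x⁻¹ p = 0 := by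
  rw [← pow_three_pow_eq_inv hx, ← hF]
  exact aeval_pow_card_eq_zero hp

/-- The product of the two quadratics with root pairs `β ^ (±4)` and `β ^ (±5)` detects membership,
so the lcm itself need not be computed. -/
theorem exists_quartic [Finite F] (hF : Nat.card F = 3 ^ s) (hβ : IsPrimitiveRoot β (3 ^ s + 1))
    (h27 : 27 ≤ 3 ^ s) :
    ∃ g : F[X], g.Monic ∧ g.natDegree = 4 ∧
      g.map (algebraMap F K) = ∏ x ∈ zeroSet β, (X - C x) ∧
      ∀ p : F[X], g ∣ p ↔ aeval (β ^ 4) p = 0 ∧ aeval (β ^ 5) p = 0 := by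
  have hU := pow_pow_three_pow_add_one hβ
  obtain ⟨p₄, hm₄, hd₄, hp₄⟩ := exists_quadratic hF (hU 4)
  obtain ⟨p₅, hm₅, hd₅, hp₅⟩ := exists_quadratic hF (hU 5)
  have hmap : (p₄ * p₅).map (algebraMap F K) = ∏ x ∈ zeroSet β, (X - C x) := by
    rw [prod_zeroSet hβ h27, Polynomial.map_mul, hp₄, hp₅]
    ring
  refine ⟨p₄ * p₅, hm₄.mul hm₅, by rw [hm₄.natDegree_mul hm₅, hd₄, hd₅], hmap, fun p => ?_⟩
  constructor
  · rintro ⟨h, rfl⟩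
    have h4 : aeval (β ^ 4) p₄ = 0 := by rw [← eval_map_algebraMap, hp₄]; simp
    have h5 : aeval (β ^ 5) p₅ = 0 := by rw [← eval_map_algebraMap, hp₅]; simp
    simp [h4, h5]
  · rintro ⟨h4, h5⟩
    rw [← Polynomial.map_dvd_map' (algebraMap F K), hmap]
    refine Finset.prod_dvd_of_coprime (fun x _ y _ hxy => ?_) fun x hx => ?_
    · exact isCoprime_X_sub_C_of_isUnit_sub (sub_ne_zero.2 hxy).isUnit
    · rw [dvd_iff_isRoot, IsRoot.def, eval_map_algebraMap]
      simp only [zeroSet, Finset.mem_insert, Finset.mem_singleton] at hx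
      rcases hx with rfl | rfl | rfl | rfl
      · exact h4
      · exact h5
      · exact aeval_inv_eq_zero hF (hU 4) h4
      · exact aeval_inv_eq_zero hF (hU 5) h5

theorem mem_bchCode_three_four_iff {n : ℕ} (hβ : β ^ n = 1) (c : Fin n → F) :
    c ∈ bchCode F β n 3 4 ↔ aeval (β ^ 4) (∑ i : Fin n, C (c i) * X ^ (i : ℕ)) = 0 ∧
      aeval (β ^ 5) (∑ i : Fin n, C (c i) * X ^ (i : ℕ)) = 0 := by
  rw [mem_bchCode_iff hβ]
  constructor
  · exact fun h => ⟨h 0 (by norm_num), h 1 (by norm_num)⟩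
  · rintro ⟨h4, h5⟩ j hj
    interval_cases j
    exacts [h4, h5]

theorem finrank_bchCode [Finite F] (hF : Nat.card F = 3 ^ s) (hβ : IsPrimitiveRoot β (3 ^ s + 1))
    (h27 : 27 ≤ 3 ^ s) : Module.finrank F (bchCode F β (3 ^ s + 1) 3 4) = 3 ^ s - 3 := by
  obtain ⟨g, hg, hdeg, -, hdvd⟩ := exists_quartic hF hβ h27
  rw [finrank_of_mem_iff_dvd _ hg (by omega) fun c => by
    rw [mem_bchCode_three_four_iff hβ.pow_eq_one, hdvd], hdeg]
  omega

theorem finrank_dualCode_bchCode [Finite F] (hF : Nat.card F = 3 ^ s)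
    (hβ : IsPrimitiveRoot β (3 ^ s + 1)) (h27 : 27 ≤ 3 ^ s) :
    Module.finrank F (dualCode (bchCode F β (3 ^ s + 1) 3 4)) = 4 := by
  have h1 := finrank_add_finrank_dualCode (bchCode F β (3 ^ s + 1) 3 4)
  rw [finrank_bchCode hF hβ h27] at h1
  omega

theorem aeval_sum_C_mul_X_pow {n : ℕ} (x : K) (c : Fin n → F) :
    aeval x (∑ i : Fin n, C (c i) * X ^ (i : ℕ)) =
      ∑ i : Fin n, algebraMap F K (c i) * x ^ (i : ℕ) := by
  simp

theorem pow_val_injective {n : ℕ} (hβ : IsPrimitiveRoot β n) :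
    Function.Injective fun i : Fin n => β ^ (i : ℕ) :=
  fun i j h => Fin.ext (hβ.pow_inj i.2 j.2 h)

open Classical in
theorem four_le_weight_bchCode [Finite F] (hF : Nat.card F = 3 ^ s)
    (hβ : IsPrimitiveRoot β (3 ^ s + 1)) (c : Fin (3 ^ s + 1) → F)
    (hc : c ∈ bchCode F β (3 ^ s + 1) 3 4) (hc0 : c ≠ 0) :
    4 ≤ (Finset.univ.filter fun i => c i ≠ 0).card := by
  have : CharP K 3 := charP_of_natCard_eq_three_pow hF
  have hβ0 : β ≠ 0 := hβ.ne_zero (by omega)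
  have hU := pow_pow_three_pow_add_one hβ
  obtain ⟨h4, h5⟩ := (mem_bchCode_three_four_iff hβ.pow_eq_one c).1 hc
  have h4' := aeval_inv_eq_zero hF (hU 4) h4
  have h5' := aeval_inv_eq_zero hF (hU 5) h5
  simp only [aeval_sum_C_mul_X_pow] at h4 h5 h4' h5'
  -- Twisting by `β ^ (-5 i)` shifts the exponents `-5, -4, 4, 5` to `0, 1, 9, 10` without changing
  -- the support.
  let w : Fin (3 ^ s + 1) → K := fun i => algebraMap F K (c i) * ((β ^ 5)⁻¹) ^ (i : ℕ)
  have hw : ∀ i, w i ≠ 0 ↔ c i ≠ 0 := fun i => by simp [w, hβ0]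
  have key : ∀ (e : ℕ) (y : K), y = (β ^ 5)⁻¹ * β ^ e →
      ∑ i, algebraMap F K (c i) * y ^ (i : ℕ) = 0 → ∑ i, w i * (β ^ (i : ℕ)) ^ e = 0 := by
    rintro e y rfl h
    rw [← h]
    refine Finset.sum_congr rfl fun i _ => ?_
    simp only [w]
    rw [mul_pow, ← pow_mul β, ← pow_mul β, mul_comm e, mul_assoc]
  have h := four_le_card_support (x := fun i : Fin (3 ^ s + 1) => β ^ (i : ℕ)) (w := w)
    (pow_val_injective hβ) ?_ (by simpa using key 0 _ (by simp) h5')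
    (by simpa using key 1 _ (by field_simp) h4') (key 9 _ (by field_simp) h4)
    (key 10 _ (by field_simp) h5)
  · simpa only [hw] using h
  · obtain ⟨i, hi⟩ := Function.ne_iff.1 hc0
    exact Function.ne_iff.2 ⟨i, (hw i).2 hi⟩

open Classical in
theorem card_zeros_dualCode_le [Finite F] (hs : Odd s) (hF : Nat.card F = 3 ^ s)
    (hβ : IsPrimitiveRoot β (3 ^ s + 1)) (h27 : 27 ≤ 3 ^ s) (v : Fin (3 ^ s + 1) → F)
    (hv : v ∈ dualCode (bchCode F β (3 ^ s + 1) 3 4)) (hv0 : v ≠ 0) :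
    (Finset.univ.filter fun i => v i = 0).card ≤ 4 := by
  have : CharP K 3 := charP_of_natCard_eq_three_pow hF
  have hβ0 : β ≠ 0 := hβ.ne_zero (by omega)
  obtain ⟨g, hg, hdeg, hmap, hdvd⟩ := exists_quartic hF hβ h27
  obtain ⟨a, ha⟩ := exists_sum_mul_pow_of_dotProduct_eq_zero (zeroSet β) hmap v fun c hc =>
    hv c (by rwa [mem_bchCode_three_four_iff hβ.pow_eq_one, ← hdvd])
  simp only [sum_zeroSet hβ h27] at ha
  rw [← Finset.card_image_of_injective _ (pow_val_injective hβ)]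
  -- These coefficients come from multiplying the vanishing combination of `x ^ (±4)`, `x ^ (±5)` by
  -- `x⁵`.
  refine card_le_four hs (a := -a (β ^ 4)⁻¹) (b := -a (β ^ 5)⁻¹) (c := a (β ^ 5)) (d := a (β ^ 4))
    ?_ _ ?_ ?_
  · rintro ⟨h1, h2, h3, h4⟩
    refine hv0 (funext fun i => ?_)
    have := ha i
    rw [neg_eq_zero.1 h1, neg_eq_zero.1 h2, h3, h4] at this
    simpa using this
  · intro x hx
    obtain ⟨i, -, rfl⟩ := Finset.mem_image.1 hx
    exact pow_pow_three_pow_add_one hβ i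
  · intro x hx
    obtain ⟨i, hi, rfl⟩ := Finset.mem_image.1 hx
    have h := ha i
    rw [(Finset.mem_filter.1 hi).2, map_zero] at h
    have hx0 : β ^ (i : ℕ) ≠ 0 := pow_ne_zero _ hβ0
    generalize a (β ^ 4)⁻¹ = a₄ at h ⊢
    generalize a (β ^ 5)⁻¹ = a₅ at h ⊢
    simp only [inv_pow, ← pow_mul, mul_comm 4 (i : ℕ), mul_comm 5 (i : ℕ)] at h
    simp only [pow_mul] at h
    field_simp at h
    linear_combination -h

end Generator

/-! ### Explicit words attaining both minimum distances -/

section Words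

variable {s : ℕ} {F : Type*} [Field F] {K : Type*} [Field K] [Algebra F K] {β : K}

theorem sq_eq_neg_one_of_isPrimitiveRoot {m n : ℕ} (hm : m ≠ 0) (hβ : IsPrimitiveRoot β n)
    (hn : n = 4 * m) : (β ^ m) ^ 2 = -1 := by
  have h4 : ((β ^ m) ^ 2 - 1) * ((β ^ m) ^ 2 + 1) = 0 := by
    have h : β ^ (4 * m) = 1 := hn ▸ hβ.pow_eq_one
    rw [mul_comm, pow_mul] at h
    linear_combination h
  refine eq_neg_of_add_eq_zero_left ((mul_eq_zero.1 h4).resolve_left fun h => ?_)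
  rw [sub_eq_zero, ← pow_mul] at h
  exact hβ.pow_ne_one_of_pos_of_lt (by omega) (by omega) h

open Classical in
theorem exists_weight_four_bchCode {m : ℕ} (hm : Odd m) (hn : 3 ^ s + 1 = 4 * m)
    (hβ : IsPrimitiveRoot β (3 ^ s + 1)) :
    ∃ c ∈ bchCode F β (3 ^ s + 1) 3 4, c ≠ 0 ∧
      (Finset.univ.filter fun i => c i ≠ 0).card ≤ 4 := by
  have hm0 : m ≠ 0 := hm.pos.ne'
  have hi := sq_eq_neg_one_of_isPrimitiveRoot hm0 hβ hn
  -- With `γ = β ^ m`, `γ² = -1`, this is `1 - 1 + 1 - 1` at `β ^ 4` and `(1 - γ)(1 + γ²)` at `β ^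
  -- 5`; both vanish.
  let p : F[X] := 1 - X ^ m + X ^ (2 * m) - X ^ (3 * m)
  have hp : p.degree < ((3 ^ s + 1 : ℕ) : WithBot ℕ) := by
    rw [hn]
    have h : p.degree ≤ (3 * m : ℕ) := by
      refine degree_le_of_natDegree_le ?_
      simp only [p]
      compute_degree
      omega
    exact h.trans_lt (by exact_mod_cast (by omega : 3 * m < 4 * m))
  refine ⟨fun i => p.coeff i, ?_, ?_, ?_⟩
  · rw [mem_bchCode_three_four_iff hβ.pow_eq_one, sum_C_coeff_mul_X_pow hp]
    simp only [p, map_sub, map_add, map_one, map_pow, aeval_X]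
    have hpow : ∀ j k : ℕ, (β ^ j) ^ (k * m) = (β ^ m) ^ (j * k) := fun j k => by
      rw [← pow_mul, ← pow_mul]; ring_nf
    have hpow' : ∀ j : ℕ, (β ^ j) ^ m = (β ^ m) ^ j := fun j => by
      rw [← pow_mul, ← pow_mul, mul_comm]
    simp only [hpow, hpow']
    generalize β ^ m = γ at hi
    have h4 : γ ^ 4 = 1 := by linear_combination (γ ^ 2 - 1) * hi
    have h8 : γ ^ 8 = 1 := by linear_combination (γ ^ 4 + 1) * h4
    have h12 : γ ^ 12 = 1 := by linear_combination γ ^ 8 * h4 + h8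
    constructor
    · linear_combination -h4 + h8 - h12
    · linear_combination -γ * h4 + γ ^ 2 * h8 - γ ^ 3 * h12 + (1 - γ) * hi
  · refine Function.ne_iff.2 ⟨0, ?_⟩
    simp [p, coeff_X_pow, coeff_one, hm0.symm, hm0]
  · have hsub : ((Finset.univ.filter fun i : Fin (3 ^ s + 1) => p.coeff i ≠ 0).image
        Fin.val) ⊆ {0, m, 2 * m, 3 * m} := by
      intro j hj
      obtain ⟨i, hi, rfl⟩ := Finset.mem_image.1 hj
      have hi := (Finset.mem_filter.1 hi).2
      by_contra hj
      simp only [Finset.mem_insert, Finset.mem_singleton, not_or] at hj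
      obtain ⟨h0, h1, h2, h3⟩ := hj
      exact hi (by simp only [p, coeff_sub, coeff_add, coeff_one, coeff_X_pow, h0, h1, h2, h3,
        if_false]; ring)
    rw [← Finset.card_image_of_injective _ Fin.val_injective]
    exact (Finset.card_le_card hsub).trans Finset.card_le_four

open Classical in
theorem exists_weight_le_dualCode [Finite F] {m : ℕ} (hm : Odd m) (hn : 3 ^ s + 1 = 4 * m)
    (hF : Nat.card F = 3 ^ s) (hβ : IsPrimitiveRoot β (3 ^ s + 1)) (h27 : 27 ≤ 3 ^ s) :
    ∃ v ∈ dualCode (bchCode F β (3 ^ s + 1) 3 4), v ≠ 0 ∧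
      (Finset.univ.filter fun i => v i ≠ 0).card ≤ 3 ^ s - 3 := by
  have hm0 : m ≠ 0 := hm.pos.ne'
  have hβ0 : β ≠ 0 := hβ.ne_zero (by omega)
  have hU := pow_pow_three_pow_add_one hβ
  have hi := sq_eq_neg_one_of_isPrimitiveRoot hm0 hβ hn
  have hinv : (β ^ m)⁻¹ = -β ^ m :=
    inv_eq_of_mul_eq_one_right (by linear_combination -hi)
  -- Frobenius negates both `β ^ m` and `x⁴ - x⁻⁴`, so their product lies in `F`.
  have hex : ∀ i : Fin (3 ^ s + 1), ∃ a : F, algebraMap F K a =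
      β ^ m * ((β ^ 4) ^ (i : ℕ) - (β ^ 4)⁻¹ ^ (i : ℕ)) := fun i => by
    apply exists_algebraMap_eq_of_pow_card_eq
    have hx : ((β ^ 4) ^ (i : ℕ)) ^ (3 ^ s + 1) = 1 := by
      rw [pow_right_comm, hU, one_pow]
    rw [mul_pow, sub_pow_natCard, hF, inv_pow, inv_pow, pow_three_pow_eq_inv hx,
      pow_three_pow_eq_inv (hU m), hinv, inv_inv]
    ring
  choose v hv using hex
  have hv0 : ∀ i, v i = 0 ↔ (β ^ 8) ^ (i : ℕ) = 1 := fun i => by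
    have hx0 : (β ^ 4) ^ (i : ℕ) ≠ 0 := pow_ne_zero _ (pow_ne_zero _ hβ0)
    rw [← map_eq_zero_iff _ (algebraMap F K).injective, hv, mul_eq_zero,
      or_iff_right (pow_ne_zero m hβ0), sub_eq_zero, inv_pow, ← mul_eq_one_iff_eq_inv₀ hx0,
      ← mul_pow, ← pow_add]
  refine ⟨v, fun c hc => ?_, ?_, ?_⟩
  · obtain ⟨h4, -⟩ := (mem_bchCode_three_four_iff hβ.pow_eq_one c).1 hc
    have h4' := aeval_inv_eq_zero hF (hU 4) h4
    rw [aeval_sum_C_mul_X_pow] at h4 h4'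
    apply (algebraMap F K).injective
    simp only [dotProduct, map_sum, map_mul, hv, map_zero]
    rw [← mul_zero (β ^ m), ← sub_self (0 : K)]
    nth_rewrite 1 [← h4]
    rw [← h4', ← Finset.sum_sub_distrib, Finset.mul_sum]
    exact Finset.sum_congr rfl fun i _ => by ring
  · refine Function.ne_iff.2 ⟨⟨1, by omega⟩, fun h => ?_⟩
    have h := (hv0 _).1 h
    rw [pow_one] at h
    exact pow_ne_one_of_le_ten hβ h27 (by norm_num) (by norm_num) h
  · rw [card_filter_ne_zero]
    -- The word vanishes where `x⁸ = 1`, in particular at `i = 0, m, 2m, 3m`.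
    have hcard : 4 ≤ (Finset.univ.filter fun i => v i = 0).card := by
      have hlt : ∀ j : Fin 4, (j : ℕ) * m < 3 ^ s + 1 := fun j => by
        rw [hn]; exact Nat.mul_lt_mul_of_pos_right j.2 hm.pos
      have hinj : Function.Injective fun j : Fin 4 => (⟨j * m, hlt j⟩ : Fin (3 ^ s + 1)) :=
        fun i j h => Fin.ext (Nat.eq_of_mul_eq_mul_right hm.pos (Fin.ext_iff.1 h))
      rw [← Finset.card_fin 4, ← Finset.card_image_of_injective _ hinj]
      refine Finset.card_le_card fun i hi => ?_
      obtain ⟨j, -, rfl⟩ := Finset.mem_image.1 hi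
      refine Finset.mem_filter.2 ⟨Finset.mem_univ _, (hv0 _).2 ?_⟩
      rw [← pow_mul, show 8 * ((j : ℕ) * m) = (4 * m) * (2 * j) by ring, ← hn, pow_mul,
        hβ.pow_eq_one, one_pow]
    omega

end Words

theorem mainTheorem8 (s : ℕ) (hs : Odd s) (hs1 : 1 < s)
    (F : Type*) [Field F] [Finite F] (hF : Nat.card F = 3 ^ s)
    (K : Type*) [Field K] [Algebra F K] (β : K) (hβ : IsPrimitiveRoot β (3 ^ s + 1)) :
    IsNMDS (bchCode F β (3 ^ s + 1) 3 4) ∧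
    HasParameters (bchCode F β (3 ^ s + 1) 3 4) (3 ^ s - 3) 4 ∧
    HasParameters (dualCode (bchCode F β (3 ^ s + 1) 3 4)) 4 (3 ^ s - 3) := by
  classical
  obtain ⟨m, hm, hn⟩ := exists_three_pow_add_one_eq hs
  have h27 := twenty_seven_le_three_pow hs hs1
  have hC : HasParameters (bchCode F β (3 ^ s + 1) 3 4) (3 ^ s - 3) 4 :=
    ⟨finrank_bchCode hF hβ h27, isMinDist_of_le (exists_weight_four_bchCode hm hn hβ)
      (four_le_weight_bchCode hF hβ)⟩
  have hD : HasParameters (dualCode (bchCode F β (3 ^ s + 1) 3 4)) 4 (3 ^ s - 3) := by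
    refine ⟨finrank_dualCode_bchCode hF hβ h27,
      isMinDist_of_le (exists_weight_le_dualCode hm hn hF hβ h27) fun v hv hv0 => ?_⟩
    have := card_zeros_dualCode_le hs hF hβ h27 v hv hv0
    rw [card_filter_ne_zero]
    omega
  exact ⟨⟨⟨_, _, hC, by omega⟩, ⟨_, _, hD, by omega⟩⟩, hC, hD⟩
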